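/- For integers $m\ge 1$ and $r\ge 1$, let $T_r(m)$ denote the Turán graph, i.e. the $m$-vertex complete $r$-partite graph with part sizes as equal as possible (so $T_r(m)=K_m$ if $m\le r$), and let $e(G)$ denote the number of edges of $G$. All graphs are finite and simple. A graph is Hamiltonian-connected if every two distinct vertices are joined by a Hamiltonian path. Let $r\ge 3$, and let $n\ge 32$ if $r=3$, $n\ge 16$ if $r=4$, and $n\ge 11$ if $r\ge 5$. Let $G$ be an $n$-vertex $K_{r+1}$-free graph. If $G$ is not Hamiltonian-connected, then $$e(G)\le e(T_r(n-1))+2.$$ Moreover, $G$ is not Hamiltonian-connected and satisfies $e(G)=e(T_r(n-1))+2$ if and only if $G$ consists of $T_r(n-1)$ plus a vertex of degree $2$, i.e. $G$ has a vertex $v$ of degree $2$ such that $G-v$ is isomorphic to $T_r(n-1)$. -/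

import Mathlib

namespace HamConn

/-- A graph is Hamiltonian-connected if every pair of distinct vertices is joined by a
Hamiltonian path. -/
def IsHamiltonianConnected {V : Type*} [DecidableEq V] (G : SimpleGraph V) : Prop :=
  ∀ u v : V, u ≠ v → ∃ p : G.Walk u v, p.IsHamiltonian

/-- With `n` the number of vertices of `G`: the graph `G` is `K_{r+1}`-free and consists of the
Turán graph `T_r(n-1)` plus a vertex of degree `d`, i.e. some vertex `v` has degree `d` in `G`
and deleting `v` leaves a graph isomorphic to `T_r(n-1)`. -/
def IsTuranPlusVertex {V : Type*} [Fintype V] (G : SimpleGraph V) [DecidableRel G.Adj]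
    (r d : ℕ) : Prop :=
  G.CliqueFree (r + 1) ∧
    ∃ v : V, G.degree v = d ∧
      Nonempty (G.induce {v}ᶜ ≃g SimpleGraph.turanGraph (Fintype.card V - 1) r)

end HamConn

/-!
If `G` is not Hamiltonian-connected, then for some `2 ≤ k ≤ n / 2` at least `k - 1` vertices have
degree at most `k`: in an edge-maximal supergraph with no Hamiltonian path from `u` to `v`, the
crossing argument shows that nonadjacent vertices have degree sum at most `n`, and a nonadjacent
pair of maximal degree sum provides `k`, the smaller of its two degrees.

Deleting `k - 1` such vertices and applying Turán's theorem to the rest gives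
`e(G) ≤ e(T_r(n - k + 1)) + k (k - 1)`. For `k ≥ 3` this is less than `e(T_r(n - 1)) + 2`, except if
`r = 3` and `k = ⌊n / 2⌋`, or if `r = 4`, `n = 16` and `k = 8`. There, the bound on the remaining
edges is nearly attained only if the rest contains many disjoint copies of `K_r`, and each of these
contains a non-neighbour of every deleted vertex, which saves edges to the deleted vertices.

For `k = 2` there is a vertex `v` of degree at most `2`, and the claim is Turán's theorem with
uniqueness for `G - v`. Conversely, the two neighbours of a vertex of degree `2` are not joined by a
Hamiltonian path.
-/

namespace HamConn

open Finset SimpleGraph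

section HamiltonianSeq

variable {V : Type*} {G H : SimpleGraph V} {u v : V} {f : ℕ → V}

/-- A Hamiltonian path from `u` to `v`, listed as the values at `0, …, |V| - 1` of a sequence, so
that vertices of the path can be addressed by index; the later values of `f` are irrelevant. -/
structure IsHamiltonianSeq [Fintype V] (G : SimpleGraph V) (u v : V) (f : ℕ → V) : Prop where
  injOn : Set.InjOn f (Set.Iio (Fintype.card V))
  map_zero : f 0 = u
  map_last : f (Fintype.card V - 1) = v
  adj : ∀ i, i + 1 < Fintype.card V → G.Adj (f i) (f (i + 1))

lemma exists_walk_support_eq_map_range (m : ℕ) (h : ∀ i < m, G.Adj (f i) (f (i + 1))) :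
    ∃ p : G.Walk (f 0) (f m), p.support = (List.range (m + 1)).map f := by
  induction m with
  | zero => exact ⟨.nil, by simp⟩
  | succ m ih =>
    obtain ⟨p, hp⟩ := ih fun i hi => h i (by omega)
    refine ⟨p.concat (h m (by omega)), ?_⟩
    rw [Walk.support_concat, hp, List.range_succ (n := m + 1), List.map_append, List.map_singleton]

lemma isHamiltonianConnected_top [Finite V] [DecidableEq V] :
    IsHamiltonianConnected (⊤ : SimpleGraph V) := by
  have := Fintype.ofFinite V
  intro u v huv
  obtain ⟨l, hne, rfl, rfl, hnodup, hmem⟩ : ∃ (l : List V) (hne : l ≠ []),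
      l.head hne = u ∧ l.getLast hne = v ∧ l.Nodup ∧ ∀ w, w ∈ l := by
    refine ⟨u :: (((univ.erase u).erase v).toList ++ [v]), List.cons_ne_nil _ _, rfl, by simp,
      ?_, fun w => ?_⟩
    · simp [List.nodup_append', nodup_toList, huv]
    · by_cases hu : w = u <;> by_cases hv : w = v <;> simp [hu, hv]
  refine ⟨Walk.ofSupport l hne hnodup.isChain, fun w => ?_⟩
  rw [Walk.support_ofSupport]
  exact List.count_eq_one_of_mem hnodup (hmem w)

variable [Fintype V]

lemma IsHamiltonianSeq.exists_walk [DecidableEq V] (h : IsHamiltonianSeq G u v f) :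
    ∃ p : G.Walk u v, p.IsHamiltonian := by
  have hpos : 0 < Fintype.card V := Fintype.card_pos_iff.2 ⟨u⟩
  obtain ⟨p, hp⟩ := exists_walk_support_eq_map_range (G := G) (f := f) (Fintype.card V - 1)
    fun i hi => h.adj i (by omega)
  obtain rfl := h.map_zero
  obtain rfl := h.map_last
  rw [Nat.sub_add_cancel hpos] at hp
  refine ⟨p, Walk.isHamiltonian_iff_isPath_and_length_eq.2 ⟨Walk.IsPath.mk' ?_, ?_⟩⟩
  · rw [hp]
    exact List.Nodup.map_on
      (fun x hx y hy => h.injOn (List.mem_range.1 hx) (List.mem_range.1 hy)) List.nodup_range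
  · have hlen := congrArg List.length hp
    rw [Walk.length_support, List.length_map, List.length_range] at hlen
    omega

lemma isHamiltonianSeq_getVert [DecidableEq V] {p : G.Walk u v} (hp : p.IsHamiltonian) :
    IsHamiltonianSeq G u v p.getVert := by
  have hpos : 0 < Fintype.card V := Fintype.card_pos_iff.2 ⟨u⟩
  have hlen := hp.length_eq
  refine ⟨hp.isPath.getVert_injOn.mono fun i hi => ?_, p.getVert_zero, ?_,
    fun i hi => p.adj_getVert_succ (by omega)⟩
  · rw [Set.mem_Iio] at hi
    exact show i ≤ p.length by omega
  · rw [← hlen, p.getVert_length]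

lemma IsHamiltonianSeq.eq_of_sym2_eq (h : IsHamiltonianSeq G u v f) {i j : ℕ}
    (hi : i + 1 < Fintype.card V) (hj : j + 1 < Fintype.card V)
    (hij : s(f i, f (i + 1)) = s(f j, f (j + 1))) : i = j := by
  have inj : ∀ {a b}, a < Fintype.card V → b < Fintype.card V → f a = f b → a = b :=
    fun ha hb => h.injOn ha hb
  rcases Sym2.eq_iff.1 hij with ⟨h₁, -⟩ | ⟨h₁, h₂⟩
  · exact inj (by omega) (by omega) h₁
  · have := inj (by omega) (by omega) h₁
    have := inj (by omega) (by omega) h₂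
    omega

lemma IsHamiltonianSeq.degree_eq_card_filter_range [DecidableRel G.Adj]
    (h : IsHamiltonianSeq H u v f) (x : V) :
    G.degree x = #{j ∈ range (Fintype.card V) | G.Adj x (f j)} := by
  classical
  have hinj : Set.InjOn f (range (Fintype.card V)) := by simpa using h.injOn
  have himage : (range (Fintype.card V)).image f = univ := by
    rw [← card_eq_iff_eq_univ, card_image_of_injOn hinj, card_range]
  rw [← G.card_neighborFinset_eq_degree, G.neighborFinset_eq_filter, ← himage, filter_image,
    card_image_of_injOn (hinj.mono (coe_subset.2 (filter_subset _ _)))]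

/-- Replaces the edges leaving positions `a` and `b` by the two chords joining their left and
their right ends. -/
lemma IsHamiltonianSeq.reverse_segment (h : IsHamiltonianSeq H u v f) {a b : ℕ} (hab : a < b)
    (hb : b + 1 < Fintype.card V)
    (hadj : ∀ i, i + 1 < Fintype.card V → i ≠ a → i ≠ b → G.Adj (f i) (f (i + 1)))
    (hleft : G.Adj (f a) (f b)) (hright : G.Adj (f (a + 1)) (f (b + 1))) :
    IsHamiltonianSeq G u v fun i => if a < i ∧ i ≤ b then f (a + 1 + b - i) else f i where
  injOn := by
    intro x hx y hy hxy
    simp only [Set.mem_Iio] at hx hy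
    simp only at hxy
    split_ifs at hxy <;>
    · have := h.injOn (Set.mem_Iio.2 (by omega)) (Set.mem_Iio.2 (by omega)) hxy
      omega
  map_zero := by simpa using h.map_zero
  map_last := by rw [if_neg (by omega)]; exact h.map_last
  adj := by
    intro i hi
    rcases eq_or_ne i a with rfl | hia
    · rwa [if_neg (by omega), if_pos (by omega), Nat.add_sub_cancel_left]
    rcases eq_or_ne i b with rfl | hib
    · rwa [if_pos (by omega), if_neg (by omega), Nat.add_sub_cancel]
    by_cases hseg : a < i ∧ i ≤ b
    · rw [if_pos hseg, if_pos (by omega)]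
      have := hadj (a + 1 + b - (i + 1)) (by omega) (by omega) (by omega)
      rw [show a + 1 + b - (i + 1) + 1 = a + 1 + b - i by omega] at this
      exact this.symm
    · rw [if_neg hseg, if_neg (by omega)]
      exact hadj i hi hia hib

lemma IsHamiltonianSeq.degree_add_degree_le [DecidableRel G.Adj] (h : IsHamiltonianSeq H u v f)
    {i : ℕ} (hi : i + 1 < Fintype.card V)
    (hadj : ∀ j, j + 1 < Fintype.card V → j ≠ i → G.Adj (f j) (f (j + 1)))
    (hG : ∀ g, ¬ IsHamiltonianSeq G u v g) :
    G.degree (f i) + G.degree (f (i + 1)) ≤ Fintype.card V := by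
  obtain ⟨m, hm⟩ : ∃ m, Fintype.card V = m + 1 := ⟨Fintype.card V - 1, by omega⟩
  let A := {j ∈ range m | G.Adj (f i) (f j)}
  let B := {j ∈ range m | G.Adj (f (i + 1)) (f (j + 1))}
  have hno_cross : ∀ j < m, G.Adj (f i) (f j) → ¬ G.Adj (f (i + 1)) (f (j + 1)) := by
    intro j hj hleft hright
    rcases lt_trichotomy i j with hij | rfl | hij
    · exact hG _ (h.reverse_segment hij (by omega) (fun l hl hli _ => hadj l hl hli) hleft hright)
    · exact hleft.ne rfl
    · exact hG _ (h.reverse_segment hij hi (fun l hl _ hli => hadj l hl hli)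
        hleft.symm hright.symm)
  have hA : G.degree (f i) ≤ #A + 1 := by
    rw [h.degree_eq_card_filter_range, hm, range_add_one, filter_insert]
    split_ifs
    · exact card_insert_le _ _
    · exact Nat.le_succ _
  have hB : G.degree (f (i + 1)) ≤ #B + 1 := by
    rw [h.degree_eq_card_filter_range, hm, card_filter, sum_range_succ', ← card_filter]
    gcongr
    split_ifs <;> simp
  have hAB : #A + #B ≤ m - 1 := by
    have hdisj : Disjoint A B := disjoint_filter.2 fun j hj => hno_cross j (mem_range.1 hj)
    have hsub : A ∪ B ⊆ (range m).erase i := by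
      refine subset_erase.2 ⟨union_subset (filter_subset _ _) (filter_subset _ _), ?_⟩
      simp [A, B]
    calc #A + #B = #(A ∪ B) := (card_union_of_disjoint hdisj).symm
      _ ≤ #((range m).erase i) := card_le_card hsub
      _ = m - 1 := by rw [card_erase_of_mem (mem_range.2 (by omega)), card_range]
  omega

lemma degree_add_degree_le_of_isHamiltonianSeq_sup_edge [DecidableRel G.Adj] {x y : V}
    (hG : ∀ g, ¬ IsHamiltonianSeq G u v g) (h : IsHamiltonianSeq (G ⊔ edge x y) u v f) :
    G.degree x + G.degree y ≤ Fintype.card V := by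
  have hmissing : ∀ i, i + 1 < Fintype.card V → ¬ G.Adj (f i) (f (i + 1)) →
      s(x, y) = s(f i, f (i + 1)) := fun i hi hni =>
    ((adj_edge _ _).1 ((h.adj i hi).resolve_left hni)).1
  obtain ⟨i, hi, hni⟩ : ∃ i, i + 1 < Fintype.card V ∧ ¬ G.Adj (f i) (f (i + 1)) := by
    by_contra! hadj
    exact hG f { h with adj := hadj }
  have hadj : ∀ j, j + 1 < Fintype.card V → j ≠ i → G.Adj (f j) (f (j + 1)) := by
    intro j hj hji
    by_contra hnj
    exact hji (h.eq_of_sym2_eq hj hi ((hmissing j hj hnj).symm.trans (hmissing i hi hni)))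
  have hle := h.degree_add_degree_le hi hadj hG
  rcases Sym2.eq_iff.1 (hmissing i hi hni) with ⟨rfl, rfl⟩ | ⟨rfl, rfl⟩ <;> omega

end HamiltonianSeq

section DegreeCondition

variable {V : Type*} [Fintype V] {G : SimpleGraph V}

lemma exists_le_ne_top_forall_degree_add_degree_le [DecidableEq V]
    (hG : ¬ IsHamiltonianConnected G) :
    ∃ (M : SimpleGraph V) (_ : DecidableRel M.Adj), G ≤ M ∧ M ≠ ⊤ ∧
      ∀ x y, x ≠ y → ¬ M.Adj x y → M.degree x + M.degree y ≤ Fintype.card V := by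
  classical
  simp only [IsHamiltonianConnected, not_forall] at hG
  obtain ⟨u, v, huv, hno⟩ := hG
  obtain ⟨M, hGM, hM⟩ := (Set.toFinite {M : SimpleGraph V | ∀ f, ¬ IsHamiltonianSeq M u v f})
    |>.exists_le_maximal (a := G) fun f hf => hno hf.exists_walk
  refine ⟨M, inferInstance, hGM, ?_, fun x y hxy hadj => ?_⟩
  · rintro rfl
    obtain ⟨p, hp⟩ := isHamiltonianConnected_top u v huv
    exact hM.prop _ (isHamiltonianSeq_getVert hp)
  · obtain ⟨f, hf⟩ := not_forall_not.1 (hM.not_prop_of_gt (M.lt_sup_edge _ _ hxy hadj))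
    exact degree_add_degree_le_of_isHamiltonianSeq_sup_edge hM.prop hf

variable [DecidableRel G.Adj]

lemma exists_not_adj_forall_degree_le (hG : G ≠ ⊤) :
    ∃ x y, x ≠ y ∧ ¬ G.Adj x y ∧ G.degree x ≤ G.degree y ∧
      ∀ w, w ≠ y → ¬ G.Adj w y → G.degree w ≤ G.degree x := by
  classical
  obtain ⟨a, b, hab, hadj⟩ := ne_top_iff_exists_not_adj.1 hG
  obtain ⟨⟨x, y⟩, hxy, hmax⟩ := exists_max_image {p : V × V | p.1 ≠ p.2 ∧ ¬ G.Adj p.1 p.2}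
    (fun p => G.degree p.1 + G.degree p.2) ⟨(a, b), by simp [hab, hadj]⟩
  simp only [mem_filter, mem_univ, true_and, Prod.forall] at hxy hmax
  rcases le_total (G.degree x) (G.degree y) with hle | hle
  · refine ⟨x, y, hxy.1, hxy.2, hle, fun w hw hwy => ?_⟩
    have := hmax w y ⟨hw, hwy⟩
    omega
  · refine ⟨y, x, hxy.1.symm, fun h => hxy.2 h.symm, hle, fun w hw hwx => ?_⟩
    have := hmax w x ⟨hw, hwx⟩
    omega

lemma exists_sub_one_le_card_degree_le_of_ore (hn : 4 ≤ Fintype.card V) (hG : G ≠ ⊤)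
    (hsum : ∀ x y, x ≠ y → ¬ G.Adj x y → G.degree x + G.degree y ≤ Fintype.card V) :
    ∃ k, 2 ≤ k ∧ 2 * k ≤ Fintype.card V ∧ k - 1 ≤ #{w | G.degree w ≤ k} := by
  classical
  obtain ⟨x, y, hxy, hadj, hle, hmax⟩ := exists_not_adj_forall_degree_le hG
  have hxy_sum := hsum x y hxy hadj
  rcases le_or_gt 2 (G.degree x) with hk | hk
  · refine ⟨G.degree x, hk, by omega, ?_⟩
    have hsub : (insert y (G.neighborFinset y))ᶜ ⊆
        ({w | G.degree w ≤ G.degree x} : Finset V) := by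
      intro w hw
      simp only [mem_compl, mem_insert, mem_neighborFinset, not_or] at hw
      exact mem_filter.2 ⟨mem_univ w, hmax w hw.1 fun h => hw.2 h.symm⟩
    calc G.degree x - 1 ≤ #(insert y (G.neighborFinset y))ᶜ := by
          rw [card_compl, card_insert_of_notMem (by simp), G.card_neighborFinset_eq_degree]
          omega
      _ ≤ _ := card_le_card hsub
  · refine ⟨2, le_rfl, by omega, card_pos.2 ⟨x, ?_⟩⟩
    exact mem_filter.2 ⟨mem_univ x, by omega⟩

lemma exists_sub_one_le_card_degree_le_of_not_isHamiltonianConnected [DecidableEq V]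
    (hn : 4 ≤ Fintype.card V) (hG : ¬ IsHamiltonianConnected G) :
    ∃ k, 2 ≤ k ∧ 2 * k ≤ Fintype.card V ∧ k - 1 ≤ #{w | G.degree w ≤ k} := by
  obtain ⟨M, _, hGM, hM, hsum⟩ := exists_le_ne_top_forall_degree_add_degree_le hG
  obtain ⟨k, hk, hkn, hcard⟩ := exists_sub_one_le_card_degree_le_of_ore hn hM hsum
  refine ⟨k, hk, hkn, hcard.trans (card_le_card fun w hw => ?_)⟩
  simp only [mem_filter, mem_univ, true_and] at hw ⊢
  exact (degree_le_of_le hGM).trans hw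

/-- An inner vertex of a path has two neighbours on it, and a vertex of degree two cannot have the
two ends of a long path as these neighbours. -/
lemma not_isHamiltonianConnected_of_degree_eq_two [DecidableEq V] (hn : 4 ≤ Fintype.card V) {w : V}
    (hw : G.degree w = 2) : ¬ IsHamiltonianConnected G := by
  intro hG
  obtain ⟨a, b, hab, hN⟩ := card_eq_two.1 ((G.card_neighborFinset_eq_degree w).trans hw)
  have hadj : ∀ c, G.Adj w c ↔ c = a ∨ c = b := fun c => by
    rw [← G.mem_neighborFinset, hN, mem_insert, mem_singleton]
  obtain ⟨p, hp⟩ := hG a b hab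
  have hlen := hp.length_eq
  have hends : ∀ j ≤ p.length, G.Adj w (p.getVert j) → j = 0 ∨ j = p.length := fun j hj h =>
    ((hadj _).1 h).imp (hp.isPath.getVert_eq_start_iff hj).1 (hp.isPath.getVert_eq_end_iff hj).1
  obtain ⟨i, rfl, hi⟩ := Walk.mem_support_iff_exists_getVert.1 (hp.mem_support w)
  have hi_start : i ≠ 0 := by
    rintro rfl
    exact ((hadj a).2 (.inl rfl)).ne p.getVert_zero
  have hi_end : i ≠ p.length := by
    rintro rfl
    exact ((hadj b).2 (.inr rfl)).ne p.getVert_length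
  have hnext := hends (i + 1) (by omega) (p.adj_getVert_succ (by omega))
  have hprev := hends (i - 1) (by omega) (by
    have := p.adj_getVert_succ (i := i - 1) (by omega)
    rw [Nat.sub_add_cancel (by omega)] at this
    exact this.symm)
  omega

end DegreeCondition

section TuranGraph

variable {r : ℕ}

lemma card_edgeFinset_turanGraph_of_le {m : ℕ} (h : m ≤ r) :
    #(turanGraph m r).edgeFinset = m.choose 2 := by
  have hcard := card_edgeFinset_top_eq_card_choose_two (V := Fin m)
  rw [Fintype.card_fin] at hcard
  convert! hcard
  exact turanGraph_eq_top.2 (.inr h)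

lemma card_edgeFinset_turanGraph_succ (hr : 0 < r) (m : ℕ) :
    #(turanGraph (m + 1) r).edgeFinset = #(turanGraph m r).edgeFinset + (m - m / r) := by
  induction m using Nat.strong_induction_on with
  | _ m ih =>
    rcases lt_or_ge m r with h | h
    · rw [card_edgeFinset_turanGraph_of_le h, card_edgeFinset_turanGraph_of_le h.le,
        Nat.div_eq_of_lt h, Nat.choose_succ_succ', Nat.choose_one_right, Nat.sub_zero, add_comm]
    · obtain ⟨m, rfl⟩ := Nat.exists_eq_add_of_le' h
      rw [add_right_comm, card_edgeFinset_turanGraph_add, card_edgeFinset_turanGraph_add,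
        ih m (by omega), Nat.add_div_right _ hr, add_one_mul]
      have := Nat.div_le_self m r
      omega

lemma card_edgeFinset_turanGraph_add_le_of_le {s : ℕ} (hr : 0 < r) (hrs : r ≤ s) (m d : ℕ) :
    #(turanGraph m s).edgeFinset + #(turanGraph (m + d) r).edgeFinset ≤
      #(turanGraph (m + d) s).edgeFinset + #(turanGraph m r).edgeFinset := by
  induction d with
  | zero => simp [add_comm]
  | succ d ih =>
    rw [← add_assoc, card_edgeFinset_turanGraph_succ hr,
      card_edgeFinset_turanGraph_succ (hr.trans_le hrs)]
    have := Nat.div_le_div_left (a := m + d) hrs hr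
    omega

lemma two_mul_mul_card_edgeFinset_turanGraph_add (hr : 0 < r) (m : ℕ) :
    2 * r * #(turanGraph m r).edgeFinset + m % r * (r - m % r) = (r - 1) * m ^ 2 := by
  have two_mul_choose (a : ℕ) : 2 * a.choose 2 = a * (a - 1) := by
    rw [Nat.choose_two_right, Nat.two_mul_div_two_of_even (Nat.even_mul_pred_self a)]
  induction m using Nat.strong_induction_on with
  | _ m ih =>
    rcases lt_or_ge m r with h | h
    · rw [card_edgeFinset_turanGraph_of_le h.le, Nat.mod_eq_of_lt h, mul_right_comm,
        two_mul_choose]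
      rcases m.eq_zero_or_pos with rfl | hm
      · simp
      zify [hm, hr, h.le]
      ring
    · obtain ⟨m, rfl⟩ := Nat.exists_eq_add_of_le' h
      have hchoose := two_mul_choose r
      have hm := ih m (by omega)
      rw [card_edgeFinset_turanGraph_add, Nat.add_mod_right]
      zify [hr, (Nat.mod_lt m hr).le] at hchoose hm ⊢
      linear_combination hm + r * hchoose

lemma le_two_mul_mul_card_edgeFinset_turanGraph_add (hr : 0 < r) (m : ℕ) :
    (r - 1) * m ^ 2 ≤ 2 * r * #(turanGraph m r).edgeFinset + r ^ 2 / 4 := by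
  rw [← two_mul_mul_card_edgeFinset_turanGraph_add hr]
  gcongr
  rw [Nat.le_div_iff_mul_le (by norm_num), mul_comm, ← mul_assoc]
  convert! four_mul_le_pow_two_add (m % r) (r - m % r)
  exact (Nat.add_sub_cancel' (Nat.mod_lt m hr).le).symm

lemma card_edgeFinset_turanGraph_add_lt (hr : 0 < r) {m n c d : ℕ}
    (h : (r - 1) * m ^ 2 + 2 * r * c + r ^ 2 / 4 < (r - 1) * n ^ 2 + 2 * r * d) :
    #(turanGraph m r).edgeFinset + c < #(turanGraph n r).edgeFinset + d := by
  have hm := mul_card_edgeFinset_turanGraph_le (n := m) (r := r)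
  have hn := le_two_mul_mul_card_edgeFinset_turanGraph_add hr n
  refine lt_of_mul_lt_mul_left ?_ (2 * r).zero_le
  rw [mul_add, mul_add]
  omega

lemma card_edgeFinset_turanGraph_add_mul_lt {n k : ℕ} (hr : 3 ≤ r)
    (hn : (if r = 3 then 32 else if r = 4 then 16 else 11) ≤ n) (hk : 3 ≤ k) (hkn : 2 * k ≤ n)
    (h3 : ¬ (r = 3 ∧ n < 2 * k + 2)) (h4 : ¬ (r = 4 ∧ n = 16 ∧ k = 8)) :
    #(turanGraph (n - k + 1) r).edgeFinset + k * (k - 1) <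
      #(turanGraph (n - 1) r).edgeFinset + 2 := by
  obtain ⟨j, rfl⟩ : ∃ j, k = j + 2 := ⟨k - 2, by omega⟩
  obtain ⟨m, rfl⟩ : ∃ m, n = m + (j + 2) := ⟨n - (j + 2), by omega⟩
  rw [show m + (j + 2) - (j + 2) + 1 = m + 1 by omega,
    show m + (j + 2) - 1 = m + 1 + j by omega, show j + 2 - 1 = j + 1 by omega]
  -- The claim reduces to `r ^ 2 / 4 < j * a` for
  -- `a = 2 * (r - 1) * (m + 1) - (r + 1) * j - 6 * r`, and `hexcess` bounds `a` from below.
  obtain rfl | rfl | hr5 : r = 3 ∨ r = 4 ∨ 5 ≤ r := by omega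
  · refine card_edgeFinset_turanGraph_add_lt (by norm_num) ?_
    rw [if_pos rfl] at hn
    have hexcess : 2 ≤ j ∧ 4 * j + 16 ≤ 4 * m ∨ 4 * j + 17 ≤ 4 * m := by omega
    norm_num
    rcases hexcess with ⟨_, _⟩ | _ <;> nlinarith
  · refine card_edgeFinset_turanGraph_add_lt (by norm_num) ?_
    rw [if_neg (by norm_num), if_pos rfl] at hn
    have hexcess : 5 ≤ j ∧ 5 * j + 19 ≤ 6 * m ∨ 5 * j + 23 ≤ 6 * m := by omega
    norm_num
    rcases hexcess with ⟨_, _⟩ | _ <;> nlinarith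
  · have hmono := card_edgeFinset_turanGraph_add_le_of_le (by norm_num) hr5 (m + 1) j
    have hfive : #(turanGraph (m + 1) 5).edgeFinset + (j + 2) * (j + 1) <
        #(turanGraph (m + 1 + j) 5).edgeFinset + 2 := by
      refine card_edgeFinset_turanGraph_add_lt (by norm_num) ?_
      rw [if_neg (by omega), if_neg (by omega)] at hn
      have hexcess : 4 ≤ j ∧ 6 * j + 24 ≤ 8 * m ∨ 6 * j + 29 ≤ 8 * m := by omega
      norm_num
      rcases hexcess with ⟨_, _⟩ | _ <;> nlinarith
    omega

variable {V : Type*} [Fintype V] {G : SimpleGraph V} [DecidableRel G.Adj]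

lemma card_edgeFinset_le_card_edgeFinset_turanGraph (hG : G.CliqueFree (r + 1)) :
    #G.edgeFinset ≤ #(turanGraph (Fintype.card V) r).edgeFinset := by
  rw [card_edgeFinset_turanGraph]
  exact hG.card_edgeFinset_le

lemma nonempty_iso_turanGraph_of_card_edgeFinset_eq (hr : 0 < r) (hG : G.CliqueFree (r + 1))
    (he : #G.edgeFinset = #(turanGraph (Fintype.card V) r).edgeFinset) :
    Nonempty (G ≃g turanGraph (Fintype.card V) r) := by
  rw [← isTuranMaximal_iff_nonempty_iso_turanGraph hr]
  exact ⟨hG, fun _ _ hH => he ▸ card_edgeFinset_le_card_edgeFinset_turanGraph hH⟩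

end TuranGraph

section Interedges

variable {V : Type*} {G : SimpleGraph V} [DecidableRel G.Adj] {A B C : Finset V} {r : ℕ}

variable (G) in
lemma card_interedges_eq_sum (A B : Finset V) :
    #(G.interedges A B) = ∑ a ∈ A, #{b ∈ B | G.Adj a b} := by
  simp only [interedges_def, card_filter, sum_product]

variable (G) in
lemma card_interedges_comm (A B : Finset V) : #(G.interedges A B) = #(G.interedges B A) :=
  have := G.symm
  Rel.card_interedges_comm A B

lemma card_interedges_union_left [DecidableEq V] (h : Disjoint A B) :
    #(G.interedges (A ∪ B) C) = #(G.interedges A C) + #(G.interedges B C) := by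
  simp only [card_interedges_eq_sum, sum_union h]

lemma card_interedges_union_right [DecidableEq V] (h : Disjoint B C) :
    #(G.interedges A (B ∪ C)) = #(G.interedges A B) + #(G.interedges A C) := by
  simp only [card_interedges_comm G A, card_interedges_union_left h]

lemma card_interedges_le {d : ℕ} (h : ∀ a ∈ A, #{b ∈ B | G.Adj a b} ≤ d) :
    #(G.interedges A B) ≤ #A * d := by
  rw [card_interedges_eq_sum]
  exact sum_le_card_nsmul A _ d h

lemma card_interedges_self (U : Finset V) :
    #(G.interedges U U) = 2 * #(G.induce (U : Set V)).edgeFinset := by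
  classical
  rw [← sum_degrees_eq_twice_card_edges, card_interedges_eq_sum, ← sum_coe_sort U]
  refine sum_congr rfl fun a _ => ?_
  rw [← card_neighborFinset_eq_degree, ← card_map (Function.Embedding.subtype _)]
  congr 1
  ext b
  simp [and_comm]

lemma card_interedges_univ [Fintype V] : #(G.interedges univ univ) = 2 * #G.edgeFinset := by
  rw [card_interedges_eq_sum, ← sum_degrees_eq_twice_card_edges]
  simp only [← card_neighborFinset_eq_degree, neighborFinset_eq_filter]

lemma card_interedges_self_le {U : Finset V} (h : G.CliqueFreeOn U (r + 1)) :
    #(G.interedges U U) ≤ 2 * #(turanGraph #U r).edgeFinset := by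
  rw [card_interedges_self]
  have hcard : Fintype.card (U : Set V) = #U := Fintype.card_coe U
  rw [← hcard]
  gcongr
  exact card_edgeFinset_le_card_edgeFinset_turanGraph ((G.cliqueFree_induce_iff _ _).2 h)

lemma card_interedges_clique_le (hG : G.CliqueFree (r + 2))
    (hC : G.IsNClique (r + 1) C) (A : Finset V) : #(G.interedges A C) ≤ #A * r := by
  classical
  refine card_interedges_le fun a _ => Nat.le_of_lt_succ ?_
  rw [Nat.succ_eq_add_one, ← hC.card_eq]
  by_contra! hall
  have hfilter := filter_eq_self.1 (eq_of_subset_of_card_le (filter_subset _ _) hall)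
  exact hG _ (hC.insert fun b hb => hfilter b hb)

/-- `q` counts the disjoint copies of `K_{r+1}` that are removed from `U` before Turán's theorem
applies to the rest: many copies force `U` to be sparse towards every other set, and few of them
force `U` itself to be sparse. -/
lemma exists_card_interedges_add_mul_le (hr : 0 < r) (hG : G.CliqueFree (r + 2)) (U : Finset V) :
    ∃ q, (∀ A, #(G.interedges A U) + #A * q ≤ #A * #U) ∧
      r * #(G.interedges U U) + #U ^ 2 + (r + 1) * q ^ 2 ≤ r * #U ^ 2 + 2 * #U * q := by
  classical
  induction hu : #U using Nat.strong_induction_on generalizing U with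
  | _ u ih =>
    subst hu
    by_cases hfree : G.CliqueFreeOn U (r + 1)
    · refine ⟨0, fun A => ?_, ?_⟩
      · exact Rel.card_interedges_le_mul _ A U
      · have hturan := card_interedges_self_le hfree
        have hbound := mul_card_edgeFinset_turanGraph_le (n := #U) (r := r)
        obtain ⟨r, rfl⟩ := Nat.exists_eq_succ_of_ne_zero hr.ne'
        rw [Nat.succ_sub_one] at hbound
        nlinarith
    · obtain ⟨C, hCU, hC⟩ : ∃ C ⊆ U, G.IsNClique (r + 1) C := by
        simpa [CliqueFreeOn] using hfree
      have hcard := card_sdiff_add_card_eq_card hCU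
      rw [hC.card_eq] at hcard
      obtain ⟨q, hq, hb⟩ := ih #(U \ C) (by omega) (U \ C) rfl
      have hdisj : Disjoint (U \ C) C := sdiff_disjoint
      have hU : U \ C ∪ C = U := sdiff_union_of_subset hCU
      have hright (A : Finset V) :
          #(G.interedges A U) = #(G.interedges A (U \ C)) + #(G.interedges A C) := by
        rw [← card_interedges_union_right hdisj, hU]
      have hself : #(G.interedges U U) = #(G.interedges (U \ C) (U \ C)) +
          2 * #(G.interedges (U \ C) C) + #(G.interedges C C) := by
        rw [hright, card_interedges_comm G U, card_interedges_comm G U, hright, hright,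
          card_interedges_comm G C (U \ C)]
        ring
      refine ⟨q + 1, fun A => ?_, ?_⟩
      · have hA := hq A
        have hAC := card_interedges_clique_le hG hC A
        rw [hright, ← hcard]
        linarith
      · have hUC := Nat.mul_le_mul_left r (card_interedges_clique_le hG hC (U \ C))
        have hCC := Nat.mul_le_mul_left r (card_interedges_clique_le hG hC C)
        rw [hC.card_eq] at hCC
        rw [hself, ← hcard]
        linarith

end Interedges

section EdgeBound

variable {V : Type*} [Fintype V] {G : SimpleGraph V} [DecidableRel G.Adj] {r : ℕ}

lemma card_interedges_le_of_degree_le {S : Finset V} {d : ℕ} (h : ∀ w ∈ S, G.degree w ≤ d)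
    (A : Finset V) : #(G.interedges S A) ≤ #S * d := by
  classical
  refine card_interedges_le fun w hw => (card_le_card fun x hx => ?_).trans (h w hw)
  exact (G.mem_neighborFinset w x).2 (mem_filter.1 hx).2

lemma two_mul_card_edgeFinset_le_of_degree_le [DecidableEq V] {S : Finset V} {d : ℕ}
    (h : ∀ w ∈ S, G.degree w ≤ d) :
    2 * #G.edgeFinset ≤ #S * d + #(G.interedges S Sᶜ) + #(G.interedges Sᶜ Sᶜ) := by
  have hS := card_interedges_le_of_degree_le h univ
  rw [← card_interedges_univ]
  nth_rw 1 [← union_compl S]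
  rw [card_interedges_union_left disjoint_compl_right, add_assoc, card_interedges_comm G S Sᶜ,
    ← card_interedges_union_right disjoint_compl_right, union_compl]
  gcongr

lemma card_edgeFinset_le_of_degree_le [DecidableEq V] (hG : G.CliqueFree (r + 1)) {S : Finset V}
    {d : ℕ} (h : ∀ w ∈ S, G.degree w ≤ d) :
    #G.edgeFinset ≤ #(turanGraph #Sᶜ r).edgeFinset + #S * d := by
  have hedges := two_mul_card_edgeFinset_le_of_degree_le h
  have hS := card_interedges_le_of_degree_le h Sᶜ
  have hSc := card_interedges_self_le (hG.cliqueFreeOn (s := ↑Sᶜ))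
  omega

lemma card_edgeFinset_lt_of_cliqueFree_four (hV : 32 ≤ Fintype.card V) (hG : G.CliqueFree 4)
    {S : Finset V} {k : ℕ} (hk : 2 * k ≤ Fintype.card V) (hk' : Fintype.card V < 2 * k + 2)
    (hS : #S = k - 1) (h : ∀ w ∈ S, G.degree w ≤ k) :
    #G.edgeFinset < #(turanGraph (Fintype.card V - 1) 3).edgeFinset + 2 := by
  classical
  have hedges := two_mul_card_edgeFinset_le_of_degree_le h
  obtain ⟨q, hq, hSc⟩ := exists_card_interedges_add_mul_le (by norm_num) hG Sᶜ
  have hcross := hq S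
  have hturan := le_two_mul_mul_card_edgeFinset_turanGraph_add (r := 3) (by norm_num)
    (Fintype.card V - 1)
  obtain ⟨s, rfl⟩ : ∃ s, k = s + 1 := ⟨k - 1, by omega⟩
  obtain ⟨d, hd⟩ : ∃ d, Fintype.card V = 2 * s + (d + 1) := ⟨Fintype.card V - 2 * s - 1, by omega⟩
  have hu : #Sᶜ = s + (d + 1) := by rw [card_compl]; omega
  rw [Nat.add_sub_cancel] at hS
  rw [hd, ← add_assoc, Nat.add_sub_cancel] at hturan ⊢
  rw [hS] at hedges
  rw [hS, hu] at hcross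
  rw [hu] at hSc
  norm_num at hturan
  -- In the bound on `12 * #G.edgeFinset`, the `q` removed triangles contribute
  -- `6 * q * (d + 1) - 9 * q ^ 2`.
  have hsq : (6 : ℤ) * q * (d + 1) ≤ 9 * q ^ 2 + (d + 1) ^ 2 := by
    linarith [sq_nonneg (3 * (q : ℤ) - (d + 1))]
  have hs : 15 * s ≤ s * s := by gcongr; omega
  zify at hedges hcross hSc hturan hs ⊢
  obtain rfl | rfl : d = 1 ∨ d = 2 := by omega
  all_goals
    push_cast at *
    linarith

lemma card_edgeFinset_lt_of_cliqueFree_five (hV : Fintype.card V = 16) (hG : G.CliqueFree 5)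
    {S : Finset V} (hS : #S = 7) (h : ∀ w ∈ S, G.degree w ≤ 8) :
    #G.edgeFinset < #(turanGraph 15 4).edgeFinset + 2 := by
  classical
  have hedges := two_mul_card_edgeFinset_le_of_degree_le h
  obtain ⟨q, hq, hSc⟩ := exists_card_interedges_add_mul_le (by norm_num) hG Sᶜ
  have hcross := hq S
  have hdeg := card_interedges_le_of_degree_le h Sᶜ
  have hturan := le_two_mul_mul_card_edgeFinset_turanGraph_add (r := 4) (by norm_num) 15
  rw [hS] at hedges hcross hdeg
  rw [card_compl, hV, hS] at hcross hSc
  have : q ≤ 9 := by omega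
  interval_cases q <;> omega

lemma card_edgeFinset_lt_of_degree_le (hr : 3 ≤ r)
    (hn : (if r = 3 then 32 else if r = 4 then 16 else 11) ≤ Fintype.card V)
    (hG : G.CliqueFree (r + 1)) {k : ℕ} (hk : 3 ≤ k) (hkn : 2 * k ≤ Fintype.card V)
    (hcard : k - 1 ≤ #{w | G.degree w ≤ k}) :
    #G.edgeFinset < #(turanGraph (Fintype.card V - 1) r).edgeFinset + 2 := by
  classical
  obtain ⟨S, hSsub, hS⟩ := exists_subset_card_eq hcard
  have h : ∀ w ∈ S, G.degree w ≤ k := fun w hw => (mem_filter.1 (hSsub hw)).2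
  by_cases h3 : r = 3 ∧ Fintype.card V < 2 * k + 2
  · obtain ⟨rfl, hk'⟩ := h3
    exact card_edgeFinset_lt_of_cliqueFree_four (by simpa using hn) hG hkn hk' hS h
  by_cases h4 : r = 4 ∧ Fintype.card V = 16 ∧ k = 8
  · obtain ⟨rfl, hV, rfl⟩ := h4
    rw [hV]
    exact card_edgeFinset_lt_of_cliqueFree_five hV hG hS h
  calc #G.edgeFinset ≤ #(turanGraph #Sᶜ r).edgeFinset + #S * k :=
        card_edgeFinset_le_of_degree_le hG h
    _ = #(turanGraph (Fintype.card V - k + 1) r).edgeFinset + k * (k - 1) := by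
        rw [card_compl, hS, mul_comm, Nat.sub_sub_right _ (by omega), Nat.sub_add_comm (by omega)]
    _ < _ := card_edgeFinset_turanGraph_add_mul_lt hr hn hk hkn h3 h4

end EdgeBound

section VertexDeletion

variable {V : Type*} [Fintype V] {G : SimpleGraph V} [DecidableRel G.Adj] {r : ℕ}

variable (G) in
lemma card_edgeFinset_induce_compl_add_degree [DecidableEq V] (v : V) :
    #(G.induce {v}ᶜ).edgeFinset + G.degree v = #G.edgeFinset := by
  rw [G.card_edgeFinset_induce_compl_singleton, G.card_edgeFinset_deleteIncidenceSet]
  refine Nat.sub_add_cancel ?_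
  rw [← G.card_incidenceFinset_eq_degree]
  exact card_le_card (G.incidenceFinset_subset v)

lemma card_compl_singleton_coe [DecidableEq V] (v : V) :
    Fintype.card ({v}ᶜ : Set V) = Fintype.card V - 1 := by
  rw [Fintype.card_compl_set, Set.card_singleton]

lemma card_edgeFinset_induce_compl_le [DecidableEq V] (hG : G.CliqueFree (r + 1))
    (v : V) :
    #(G.induce {v}ᶜ).edgeFinset ≤ #(turanGraph (Fintype.card V - 1) r).edgeFinset := by
  rw [← card_compl_singleton_coe v]
  exact card_edgeFinset_le_card_edgeFinset_turanGraph (hG.comap (Embedding.induce _).isContained)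

lemma card_edgeFinset_le_add_degree (hG : G.CliqueFree (r + 1)) (v : V) :
    #G.edgeFinset ≤ #(turanGraph (Fintype.card V - 1) r).edgeFinset + G.degree v := by
  classical
  rw [← card_edgeFinset_induce_compl_add_degree G v]
  gcongr
  exact card_edgeFinset_induce_compl_le hG v

lemma nonempty_induce_compl_iso_turanGraph (hr : 0 < r) (hG : G.CliqueFree (r + 1)) {v : V}
    (he : #G.edgeFinset = #(turanGraph (Fintype.card V - 1) r).edgeFinset + G.degree v) :
    Nonempty (G.induce {v}ᶜ ≃g turanGraph (Fintype.card V - 1) r) := by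
  classical
  rw [← card_edgeFinset_induce_compl_add_degree G v, Nat.add_right_cancel_iff,
    ← card_compl_singleton_coe v] at he
  rw [← card_compl_singleton_coe v]
  exact nonempty_iso_turanGraph_of_card_edgeFinset_eq hr
    (hG.comap (Embedding.induce _).isContained) he

lemma card_edgeFinset_lt_or_exists_degree_le_two [DecidableEq V] (hr : 3 ≤ r)
    (hn : (if r = 3 then 32 else if r = 4 then 16 else 11) ≤ Fintype.card V)
    (hG : G.CliqueFree (r + 1)) (hH : ¬ IsHamiltonianConnected G) :
    #G.edgeFinset < #(turanGraph (Fintype.card V - 1) r).edgeFinset + 2 ∨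
      ∃ v, G.degree v ≤ 2 := by
  have hV : 4 ≤ Fintype.card V := by split_ifs at hn <;> omega
  obtain ⟨k, hk, hkn, hcard⟩ := exists_sub_one_le_card_degree_le_of_not_isHamiltonianConnected hV hH
  rcases hk.eq_or_lt with rfl | hk
  · obtain ⟨v, hv⟩ := card_pos.1 hcard
    exact .inr ⟨v, (mem_filter.1 hv).2⟩
  · exact .inl (card_edgeFinset_lt_of_degree_le hr hn hG hk hkn hcard)

end VertexDeletion

end HamConn

open HamConn in
theorem mainTheorem3 {V : Type*} [Fintype V] [DecidableEq V] (G : SimpleGraph V)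
    [DecidableRel G.Adj] (n r : ℕ) (hV : Fintype.card V = n) (hr : 3 ≤ r)
    (hn : (if r = 3 then 32 else if r = 4 then 16 else 11) ≤ n)
    (hG : G.CliqueFree (r + 1)) :
    (¬ HamConn.IsHamiltonianConnected G →
      G.edgeFinset.card ≤ (SimpleGraph.turanGraph (n - 1) r).edgeFinset.card + 2) ∧
    ((¬ HamConn.IsHamiltonianConnected G ∧
        G.edgeFinset.card = (SimpleGraph.turanGraph (n - 1) r).edgeFinset.card + 2) ↔
      HamConn.IsTuranPlusVertex G r 2) := by
  subst hV
  have hlow := card_edgeFinset_lt_or_exists_degree_le_two hr hn hG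
  refine ⟨fun hH => ?_, fun ⟨hH, he⟩ => ⟨hG, ?_⟩, fun ⟨_, v, hv, ⟨φ⟩⟩ => ⟨?_, ?_⟩⟩
  · obtain hlt | ⟨v, hv⟩ := hlow hH
    · exact hlt.le
    · exact (card_edgeFinset_le_add_degree hG v).trans (by gcongr)
  · obtain hlt | ⟨v, hv⟩ := hlow hH
    · exact absurd he hlt.ne
    · have hdeg : G.degree v = 2 := by
        have := card_edgeFinset_le_add_degree hG v
        omega
      exact ⟨v, hdeg, nonempty_induce_compl_iso_turanGraph (by omega) hG (hdeg.symm ▸ he)⟩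
  · exact not_isHamiltonianConnected_of_degree_eq_two (by split_ifs at hn <;> omega) hv
  · rw [← card_edgeFinset_induce_compl_add_degree G v, hv, φ.card_edgeFinset_eq]
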